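/- Let $n,d\ge 1$ and let $\Delta_{m-1}=\operatorname{conv}\{e_1,\dots,e_m\}\subseteq\mathbb{R}^m$ denote the standard $(m-1)$-dimensional simplex. A triangulation of $\Delta_{n-1}\times\Delta_{d-1}$ is a geometric simplicial complex in $\mathbb{R}^n\times\mathbb{R}^d$ whose underlying space is $\Delta_{n-1}\times\Delta_{d-1}$ and all of whose vertices are among the vertices $(e_j,e_i)$, $1\le j\le n$, $1\le i\le d$, of this polytope. Then the number of triangulations of $\Delta_{n-1}\times\Delta_{d-1}$ is finite and at most $$\binom{n+d-2}{d-1}!\,.$$ -/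

import Mathlib

/-- The product of simplices `Δ_{n-1} × Δ_{d-1}`, where `Δ_{m-1} = conv {e_1, …, e_m} ⊆ ℝ^m`. -/
def simplexProduct (n d : ℕ) : Set ((Fin n → ℝ) × (Fin d → ℝ)) :=
  stdSimplex ℝ (Fin n) ×ˢ stdSimplex ℝ (Fin d)

/-- The vertices `(e_j, e_i)` of `Δ_{n-1} × Δ_{d-1}`. -/
def simplexProductVertices (n d : ℕ) : Set ((Fin n → ℝ) × (Fin d → ℝ)) :=
  Set.range fun p : Fin n × Fin d => (Pi.single p.1 1, Pi.single p.2 1)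

/-- The triangulations of `Δ_{n-1} × Δ_{d-1}`: the geometric simplicial complexes whose underlying
space is the polytope and all of whose vertices are vertices of the polytope. -/
def simplexProductTriangulations (n d : ℕ) :
    Set (Geometry.SimplicialComplex ℝ ((Fin n → ℝ) × (Fin d → ℝ))) :=
  {K | K.space = simplexProduct n d ∧ K.vertices ⊆ simplexProductVertices n d}

/-! A set of vertices of the product is a bipartite graph, and a point of the cone over it is a pair
of margins of a nonnegative matrix. A triangulation becomes a subgraph-closed family of graphs in
which each balanced nonnegative pair of margins has exactly one nonnegative matrix
(`IsTriangulation`). Its maximal members are spanning trees (`exists_tree_ge`).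

Within one triangulation, each positive vector of the right total is the left degree vector of
exactly one spanning tree (`exists_tree`, `tree_unique`), and by transposition the same holds on the
right. Sending left degrees to right degrees is thus a bijection between two sets of `N =
(n+d-2).choose (d-1)` vectors (`exists_equiv`).

This bijection determines the triangulation (`eq_of_degreePairs_eq`), so there are at most `N!`
triangulations. The determination is by induction on trees: a tree has a leaf, the degree pairs
force where that leaf is attached (`leaf_eq_of_degreePairs_eq`), and they also determine the degree
pairs after the leaf is deleted. -/

namespace SimplexProduct

open Finset
open scoped Classical

variable {ι κ : Type*}

/-! ### Bipartite graphs, margins and acyclicity. -/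

/-- A matrix is supported on a relation. -/
def SuppIn (M : ι → κ → ℝ) (F : ι → κ → Prop) : Prop :=
  ∀ j i, M j i ≠ 0 → F j i

/-- The support of a matrix, as a relation. -/
def supp (M : ι → κ → ℝ) : ι → κ → Prop := fun j i => M j i ≠ 0

/-- The relation obtained from `F` by deleting the edge `(j₀, i₀)`. -/
def eraseEdge (F : ι → κ → Prop) (j₀ : ι) (i₀ : κ) : ι → κ → Prop :=
  fun j i => F j i ∧ ¬ (j = j₀ ∧ i = i₀)

/-- `j₀` is a leaf of `F`, and `i₀` is its only neighbour. -/
def IsLeaf (F : ι → κ → Prop) (j₀ : ι) (i₀ : κ) : Prop :=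
  F j₀ i₀ ∧ ∀ i, F j₀ i → i = i₀

lemma flip_eraseEdge (F : ι → κ → Prop) (j₀ : ι) (i₀ : κ) :
    flip (eraseEdge F j₀ i₀) = eraseEdge (flip F) i₀ j₀ := by
  funext i j
  simp only [flip, eraseEdge, and_comm (a := j = j₀)]

lemma eq_of_eraseEdge_eq {F G : ι → κ → Prop} {j₀ : ι} {i₀ : κ} (hF : F j₀ i₀) (hG : G j₀ i₀)
    (h : eraseEdge F j₀ i₀ = eraseEdge G j₀ i₀) : F = G := by
  funext j i
  by_cases hji : j = j₀ ∧ i = i₀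
  · obtain ⟨rfl, rfl⟩ := hji
    simp [hF, hG]
  · simpa [eraseEdge, hji] using congrFun (congrFun h j) i

lemma sum_ite_and_right [Fintype ι] (j₀ : ι) (i₀ i : κ) (c : ℝ) :
    ∑ j, (if j = j₀ ∧ i = i₀ then c else 0) = if i = i₀ then c else 0 := by
  by_cases h : i = i₀ <;> simp [h]

variable [Fintype κ]

/-- The degree of the left vertex `j`. -/
noncomputable def deg (F : ι → κ → Prop) (j : ι) : ℕ := ∑ i, if F j i then 1 else 0

lemma sum_ite_and_left (j₀ j : ι) (i₀ : κ) (c : ℝ) :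
    ∑ i, (if j = j₀ ∧ i = i₀ then c else 0) = if j = j₀ then c else 0 := by
  by_cases h : j = j₀ <;> simp [h]

lemma deg_eraseEdge {F : ι → κ → Prop} {j₀ : ι} {i₀ : κ} (h : F j₀ i₀) (j : ι) :
    deg F j = deg (eraseEdge F j₀ i₀) j + if j = j₀ then 1 else 0 := by
  have : (if j = j₀ then 1 else 0) = ∑ i, if j = j₀ ∧ i = i₀ then 1 else 0 := by
    by_cases h : j = j₀ <;> simp [h]
  rw [deg, deg, this, ← sum_add_distrib]
  refine sum_congr rfl fun i _ => ?_
  by_cases hji : j = j₀ ∧ i = i₀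
  · simp [eraseEdge, hji.1, hji.2, h]
  · simp [eraseEdge, hji]

lemma deg_eq_one_iff {F : ι → κ → Prop} {j : ι} : deg F j = 1 ↔ ∃ i, IsLeaf F j i := by
  simp [deg, IsLeaf, card_eq_one, Finset.ext_iff]
  refine exists_congr fun i => ⟨fun h => ⟨(h i).2 rfl, fun i' => (h i').1⟩, fun h i' => ⟨h.2 i', ?_⟩⟩
  rintro rfl
  exact h.1

lemma deg_ne_zero_iff {F : ι → κ → Prop} {j : ι} : deg F j ≠ 0 ↔ ∃ i, F j i := by
  simp [deg]

lemma deg_flip_eraseEdge {F : κ → ι → Prop} {j₀ : κ} {i₀ : ι} (h : F j₀ i₀) (i : ι) :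
    deg (flip F) i = deg (flip (eraseEdge F j₀ i₀)) i + if i = i₀ then 1 else 0 := by
  rw [flip_eraseEdge]
  exact deg_eraseEdge (F := flip F) h i

variable [Fintype ι]

/-- `M` has row sums `x` and column sums `y`. -/
def HasMargins (M : ι → κ → ℝ) (x : ι → ℝ) (y : κ → ℝ) : Prop :=
  (∀ j, ∑ i, M j i = x j) ∧ ∀ i, ∑ j, M j i = y i

/-- A bipartite graph is acyclic when its edge vectors `(e_j, e_i)` are linearly independent. -/
def Acyclic (F : ι → κ → Prop) : Prop :=
  ∀ M : ι → κ → ℝ, SuppIn M F → HasMargins M 0 0 → M = 0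

protected lemma HasMargins.flip {M : ι → κ → ℝ} {x : ι → ℝ} {y : κ → ℝ} (h : HasMargins M x y) :
    HasMargins (flip M) y x := ⟨h.2, h.1⟩

lemma HasMargins.sub {M N : ι → κ → ℝ} {x x' : ι → ℝ} {y y' : κ → ℝ} (h : HasMargins M x y)
    (h' : HasMargins N x' y') : HasMargins (M - N) (x - x') (y - y') :=
  ⟨fun j => by simp [← h.1, ← h'.1], fun i => by simp [← h.2, ← h'.2]⟩

lemma HasMargins.smul {M : ι → κ → ℝ} {x : ι → ℝ} {y : κ → ℝ} (c : ℝ) (h : HasMargins M x y) :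
    HasMargins (c • M) (c • x) (c • y) :=
  ⟨fun j => by simp [← h.1, mul_sum], fun i => by simp [← h.2, mul_sum]⟩

lemma HasMargins.sum_eq {M : ι → κ → ℝ} {x : ι → ℝ} {y : κ → ℝ} (h : HasMargins M x y) :
    ∑ j, x j = ∑ i, y i := by
  simp_rw [← h.1, ← h.2]
  exact sum_comm

protected lemma Acyclic.flip {F : ι → κ → Prop} (h : Acyclic F) : Acyclic (flip F) := fun M hM hM0 => by
  have := h (flip M) (fun j i => hM i j) hM0.flip
  funext i j
  exact congrFun (congrFun this j) i

lemma Acyclic.mono {F G : ι → κ → Prop} (h : Acyclic F) (hGF : ∀ j i, G j i → F j i) :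
    Acyclic G := fun M hM => h M fun j i hji => hGF j i (hM j i hji)

lemma Acyclic.eq_of_hasMargins {F : ι → κ → Prop} (h : Acyclic F) {M N : ι → κ → ℝ}
    (hM : SuppIn M F) (hN : SuppIn N F) {x : ι → ℝ} {y : κ → ℝ} (hMx : HasMargins M x y)
    (hNx : HasMargins N x y) : M = N := by
  rw [← sub_eq_zero]
  refine h _ (fun j i hji => ?_) (by simpa using hMx.sub hNx)
  by_contra hF
  exact hji (by simp [not_imp_comm.1 (hM j i) hF, not_imp_comm.1 (hN j i) hF])

/-- A nonempty acyclic bipartite graph has a leaf. -/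
lemma Acyclic.exists_leaf {F : ι → κ → Prop} (h : Acyclic F) (hne : ∃ j i, F j i) :
    (∃ j i, IsLeaf F j i) ∨ ∃ i j, IsLeaf (flip F) i j := by
  by_contra! hcon
  obtain ⟨hrow, hcol⟩ := hcon
  have hrow' : ∀ j i, F j i → ∃ i', F j i' ∧ i' ≠ i := fun j i hF => by
    by_contra! hc
    exact hrow j i ⟨hF, hc⟩
  have hcol' : ∀ i j, F j i → ∃ j', F j' i ∧ j' ≠ j := fun i j hF => by
    by_contra! hc
    exact hcol i j ⟨hF, hc⟩
  obtain ⟨j₀, i₀, h₀⟩ := hne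
  let E := {p : ι × κ // F p.1 p.2}
  let R := {j : ι // ∃ i, F j i}
  -- One column is omitted because its sum follows from the other margins; this is what makes the
  -- dimension count strict.
  let C := {i : κ // (∃ j, F j i) ∧ i ≠ i₀}
  choose a ha using fun j : R => j.2
  choose a' ha' hne' using fun j : R => hrow' j _ (ha j)
  choose b hb using fun i : C => i.2.1
  choose b' hb' hneb' using fun i : C => hcol' i _ (hb i)
  have hR : Fintype.card R * 2 ≤ Fintype.card E := by
    let f : R × Bool → E := fun p => if p.2 then ⟨(p.1, a p.1), ha _⟩ else ⟨(p.1, a' p.1), ha' _⟩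
    have hf : Function.Injective f := by
      rintro ⟨j, s⟩ ⟨j', s'⟩ heq
      have h1 : j = j' := by
        have := congrArg (fun e : E => e.1.1) heq
        cases s <;> cases s' <;> exact Subtype.ext (by simpa [f] using this)
      subst h1
      have h2 := congrArg (fun e : E => e.1.2) heq
      cases s <;> cases s' <;> simp [f, hne' j, (hne' j).symm] at h2 ⊢
    simpa using Fintype.card_le_of_injective f hf
  have hC : Fintype.card C * 2 < Fintype.card E := by
    let f : C × Bool → E := fun p => if p.2 then ⟨(b p.1, p.1), hb _⟩ else ⟨(b' p.1, p.1), hb' _⟩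
    have hf : Function.Injective f := by
      rintro ⟨j, s⟩ ⟨j', s'⟩ heq
      have h1 : j = j' := by
        have := congrArg (fun e : E => e.1.2) heq
        cases s <;> cases s' <;> exact Subtype.ext (by simpa [f] using this)
      subst h1
      have h2 := congrArg (fun e : E => e.1.1) heq
      cases s <;> cases s' <;> simp [f, hneb' j, (hneb' j).symm] at h2 ⊢
    have hnot : (⟨(j₀, i₀), h₀⟩ : E) ∉ Set.range f := by
      rintro ⟨⟨c, s⟩, hc⟩
      have := congrArg (fun e : E => e.1.2) hc
      refine c.2.2 ?_
      cases s <;> simpa [f] using this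
    simpa using Fintype.card_lt_of_injective_of_notMem f hf hnot
  let X : (E → ℝ) →ₗ[ℝ] (ι → κ → ℝ) :=
    { toFun := fun v j i => if hF : F j i then v ⟨(j, i), hF⟩ else 0
      map_add' := fun v w => by
        funext j i
        by_cases hF : F j i <;> simp [hF]
      map_smul' := fun c v => by
        funext j i
        by_cases hF : F j i <;> simp [hF] }
  let L : (E → ℝ) →ₗ[ℝ] (R → ℝ) × (C → ℝ) :=
    { toFun := fun v => (fun j => ∑ i, X v j i, fun i => ∑ j, X v j i)
      map_add' := fun v w => by
        ext <;> simp [sum_add_distrib]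
      map_smul' := fun c v => by
        ext <;> simp [mul_sum] }
  -- Without leaves, `2|R| ≤ |E|` and `2|C| < |E|`, so there are fewer margin equations than edges.
  have hker : LinearMap.ker L ≠ ⊥ := by
    apply LinearMap.ker_ne_bot_of_finrank_lt
    simp only [Module.finrank_prod, Module.finrank_fintype_fun_eq_card]
    omega
  obtain ⟨v, hv, hv0⟩ := Submodule.exists_mem_ne_zero_of_ne_bot hker
  have hX : ∀ j i, ¬ F j i → X v j i = 0 := fun j i hF => by simp [X, hF]
  have hL : L v = 0 := hv
  have hrows : ∀ j, ∑ i, X v j i = 0 := fun j => by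
    by_cases hj : ∃ i, F j i
    · exact congrFun (congrArg Prod.fst hL) ⟨j, hj⟩
    · push Not at hj
      exact sum_eq_zero fun i _ => hX j i (hj i)
  have hcols' : ∀ i, i ≠ i₀ → ∑ j, X v j i = 0 := fun i hi => by
    by_cases hj : ∃ j, F j i
    · exact congrFun (congrArg Prod.snd hL) ⟨i, hj, hi⟩
    · push Not at hj
      exact sum_eq_zero fun j _ => hX j i (hj j)
  have hcol₀ : ∑ j, X v j i₀ = 0 := by
    have h1 : ∑ i, ∑ j, X v j i = 0 := by
      rw [sum_comm]
      exact sum_eq_zero fun j _ => hrows j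
    rwa [sum_eq_single i₀ (fun i _ hi => hcols' i hi) (by simp)] at h1
  have hXv : X v = 0 := h (X v) (fun j i hji => by_contra fun hF => hji (hX j i hF))
    ⟨hrows, fun i => by
      by_cases hi : i = i₀
      · rw [hi]; exact hcol₀
      · exact hcols' i hi⟩
  apply hv0
  funext ⟨⟨j, i⟩, hF⟩
  have hF' : F j i := hF
  have := congrFun (congrFun hXv j) i
  simpa [X, hF'] using this

/-- The entries of a matrix with acyclic support lie in every additive group that contains the
row and column sums. -/
lemma Acyclic.mem_addSubgroup (G : AddSubgroup ℝ) {F : ι → κ → Prop} (h : Acyclic F)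
    {M : ι → κ → ℝ} (hM : SuppIn M F) (hr : ∀ j, ∑ i, M j i ∈ G) (hc : ∀ i, ∑ j, M j i ∈ G)
    (j : ι) (i : κ) : M j i ∈ G := by
  induction hN : ∑ j, deg F j using Nat.strong_induction_on generalizing F M j i with
  | _ N ih =>
  by_cases hne : ∃ j i, F j i
  swap
  · push Not at hne
    rw [not_imp_comm.1 (hM j i) (hne j i)]
    exact G.zero_mem
  -- The entry at a leaf edge is an entire row or column sum. Subtracting it leaves a matrix on a
  -- smaller graph.
  obtain ⟨j₀, i₀, h₀, hG⟩ : ∃ j₀ i₀, F j₀ i₀ ∧ M j₀ i₀ ∈ G := by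
    rcases h.exists_leaf hne with ⟨j₀, i₀, h₀, h₁⟩ | ⟨i₀, j₀, h₀, h₁⟩
    · refine ⟨j₀, i₀, h₀, ?_⟩
      have := hr j₀
      rwa [sum_eq_single i₀ (fun i _ hi => not_imp_comm.1 (hM j₀ i) fun hF => hi (h₁ i hF))
        (by simp)] at this
    · refine ⟨j₀, i₀, h₀, ?_⟩
      have := hc i₀
      rwa [sum_eq_single j₀ (fun j _ hj => not_imp_comm.1 (hM j i₀) fun hF => hj (h₁ j hF))
        (by simp)] at this
  let M' : ι → κ → ℝ := fun j i => M j i - if j = j₀ ∧ i = i₀ then M j₀ i₀ else 0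
  have key : M' j i ∈ G := by
    refine ih (∑ j, deg (eraseEdge F j₀ i₀) j) ?_ (F := eraseEdge F j₀ i₀)
      (h.mono fun j i hji => hji.1) (M := M') ?_ ?_ ?_ j i rfl
    · rw [← hN]
      simp_rw [deg_eraseEdge h₀, sum_add_distrib]
      simp
    · intro j i hji
      by_cases hh : j = j₀ ∧ i = i₀
      · obtain ⟨rfl, rfl⟩ := hh
        simp [M'] at hji
      · exact ⟨hM j i (by simpa [M', hh] using hji), hh⟩
    · intro j
      simp only [M', sum_sub_distrib, sum_ite_and_left]
      refine G.sub_mem (hr j) ?_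
      split_ifs
      exacts [hG, G.zero_mem]
    · intro i
      simp only [M', sum_sub_distrib, sum_ite_and_right]
      refine G.sub_mem (hc i) ?_
      split_ifs
      exacts [hG, G.zero_mem]
  by_cases hh : j = j₀ ∧ i = i₀
  · rw [hh.1, hh.2]
    exact hG
  · simpa [M', hh] using key

/-! ### Spanning trees and their orientations. -/

/-- `T` is a spanning tree of the complete bipartite graph on `A` and `B`. -/
structure TreeOn (A : Finset ι) (B : Finset κ) (T : ι → κ → Prop) : Prop where
  mem : ∀ j i, T j i → j ∈ A ∧ i ∈ B
  acyclic : Acyclic T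
  connected : ∀ A' ⊆ A, ∀ B' ⊆ B, (∀ j i, T j i → (j ∈ A' ↔ i ∈ B')) →
    (A' = ∅ ∧ B' = ∅) ∨ (A' = A ∧ B' = B)

namespace TreeOn

variable {A : Finset ι} {B : Finset κ} {T : ι → κ → Prop}

protected lemma flip (h : TreeOn A B T) : TreeOn B A (flip T) where
  mem i j hT := (h.mem j i hT).symm
  acyclic := h.acyclic.flip
  connected B' hB A' hA hT := by
    rcases h.connected A' hA B' hB fun j i hji => (hT i j hji).symm with h' | h'
    exacts [Or.inl h'.symm, Or.inr h'.symm]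

lemma eraseEdge (h : TreeOn A B T) {j₀ : ι} {i₀ : κ} (hl : IsLeaf T j₀ i₀) :
    TreeOn (A.erase j₀) B (eraseEdge T j₀ i₀) where
  mem j i hT := by
    refine ⟨mem_erase.2 ⟨?_, (h.mem j i hT.1).1⟩, (h.mem j i hT.1).2⟩
    rintro rfl
    exact hT.2 ⟨rfl, hl.2 i hT.1⟩
  acyclic := h.acyclic.mono fun j i hji => hji.1
  connected A' hA B' hB hT := by
    have hj₀ : j₀ ∈ A := (h.mem _ _ hl.1).1
    have hi₀ : i₀ ∈ B := (h.mem _ _ hl.1).2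
    have hjA : j₀ ∉ A' := fun hh => by simpa using hA hh
    -- A union of components of the smaller graph extends to the tree by placing the leaf with its
    -- only neighbour.
    have hcon := h.connected (if i₀ ∈ B' then insert j₀ A' else A') (by
      split_ifs
      · exact insert_subset hj₀ (hA.trans (erase_subset _ _))
      · exact hA.trans (erase_subset _ _)) B' hB (fun j i hji => by
        by_cases hj : j = j₀
        · subst hj
          obtain rfl := hl.2 i hji
          by_cases hi : i ∈ B' <;> simp [hi, hjA]
        · have := hT j i ⟨hji, fun hh => hj hh.1⟩
          split_ifs <;> simp [hj, this])
    rcases hcon with ⟨h1, h2⟩ | ⟨h1, h2⟩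
    · subst h2
      exact Or.inl ⟨by simpa using h1, rfl⟩
    · subst h2
      rw [if_pos hi₀] at h1
      exact Or.inr ⟨by rw [← h1, erase_insert hjA], rfl⟩

lemma exists_edge (h : TreeOn A B T) (hB : B.Nonempty) {j : ι} (hj : j ∈ A) : ∃ i, T j i := by
  by_contra! hcon
  rcases h.connected {j} (by simpa using hj) ∅ (by simp) (fun j' i hji => by
    have : j' ≠ j := by
      rintro rfl
      exact hcon i hji
    simpa using this) with h' | h'
  · simpa using h'.1
  · exact hB.ne_empty h'.2.symm

lemma deg_ne_zero_iff (h : TreeOn A B T) (hB : B.Nonempty) (j : ι) : deg T j ≠ 0 ↔ j ∈ A := by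
  rw [SimplexProduct.deg_ne_zero_iff]
  exact ⟨fun ⟨i, hi⟩ => (h.mem j i hi).1, h.exists_edge hB⟩

/-- Orient a spanning tree towards a root `v`: the matrix of the edges whose lower end is a right
vertex. -/
lemma exists_orientation (h : TreeOn A B T) (v : ι ⊕ κ) (hv : v ∈ A.disjSum B) :
    ∃ X : ι → κ → ℝ, SuppIn X T ∧ (∀ j i, X j i = 0 ∨ X j i = 1) ∧
      HasMargins X
        (fun j => deg T j - (if j ∈ A then 1 else 0) + if v = Sum.inl j then 1 else 0)
        (fun i => (if i ∈ B then 1 else 0) - if v = Sum.inr i then 1 else 0) := by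
  -- Each non-root vertex owns the first edge on its path to the root, and `X` marks the edges owned
  -- by right vertices. So a column sums to one except at the root, and a row misses just the edge
  -- owned by its vertex, if any. The induction deletes a leaf.
  induction hN : A.card + B.card using Nat.strong_induction_on generalizing A B T v with
  | _ N ih =>
  by_cases hne : ∃ j i, T j i
  swap
  · push Not at hne
    refine ⟨0, fun j i h0 => by simp at h0, fun j i => by simp, ?_⟩
    have hdeg : ∀ j, deg T j = 0 := fun j => by simp [deg, hne]
    rcases v with v | v
    · have hvA : v ∈ A := by simpa using hv
      obtain ⟨rfl, rfl⟩ : {v} = A ∧ ∅ = B := by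
        rcases h.connected {v} (by simpa using hvA) ∅ (by simp)
          (fun j i hji => absurd hji (hne j i)) with h' | h'
        · simp at h'
        · exact h'
      constructor
      · intro j
        by_cases hj : j = v
        · simp [hdeg, hj]
        · simp [hdeg, hj, Ne.symm hj]
      · intro i
        simp
    · have hvA : v ∈ B := by simpa using hv
      obtain ⟨rfl, rfl⟩ : ∅ = A ∧ {v} = B := by
        rcases h.connected ∅ (by simp) {v} (by simpa using hvA)
          (fun j i hji => absurd hji (hne j i)) with h' | h'
        · simp at h'
        · exact h'
      constructor
      · intro j
        simp [hdeg]
      · intro j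
        by_cases hj : j = v
        · simp [hj]
        · simp [hj, Ne.symm hj]
  rcases h.acyclic.exists_leaf hne with ⟨j₀, i₀, hl⟩ | ⟨i₀, j₀, hl⟩
  · have hT' := h.eraseEdge hl
    obtain ⟨hj₀, hi₀⟩ := h.mem _ _ hl.1
    have hcard : (A.erase j₀).card + B.card < N := by
      have := card_erase_lt_of_mem hj₀
      omega
    -- If the leaf is the root, the smaller tree is rooted at `i₀`, which then owns the deleted
    -- edge; otherwise the leaf owns it and `X` is unchanged.
    by_cases hv₀ : v = Sum.inl j₀
    · obtain ⟨X, hX, h01, hXm⟩ := ih _ hcard hT' (Sum.inr i₀) (by simpa using hi₀) rfl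
      have hX0 : X j₀ i₀ = 0 := by
        by_contra hh
        exact (hX _ _ hh).2 ⟨rfl, rfl⟩
      refine ⟨fun j i => X j i + if j = j₀ ∧ i = i₀ then 1 else 0, fun j i hji => ?_,
        fun j i => ?_, fun j => ?_, fun i => ?_⟩
      · by_cases hh : j = j₀ ∧ i = i₀
        · rw [hh.1, hh.2]
          exact hl.1
        · exact (hX j i (by simpa [hh] using hji)).1
      · by_cases hh : j = j₀ ∧ i = i₀
        · simp [hh.1, hh.2, hX0]
        · simpa [hh] using h01 j i
      · simp only [sum_add_distrib, sum_ite_and_left, hXm.1, deg_eraseEdge hl.1 j, hv₀]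
        by_cases hj : j = j₀
        · simp [hj, hj₀]
        · simp [hj, Ne.symm hj]
      · simp only [sum_add_distrib, sum_ite_and_right, hXm.2, hv₀]
        by_cases hi : i = i₀
        · simp [hi]
        · simp [hi, Ne.symm hi]
    · obtain ⟨X, hX, h01, hXm⟩ := ih _ hcard hT' v (by
        rcases v with v | v
        · simp at hv hv₀ ⊢
          exact ⟨hv₀, hv⟩
        · simpa using hv) rfl
      refine ⟨X, fun j i hji => (hX j i hji).1, h01, fun j => ?_, hXm.2⟩
      simp only [hXm.1, deg_eraseEdge hl.1 j]
      by_cases hj : j = j₀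
      · simp [hj, hj₀]
      · simp [hj]
  · have hT' : TreeOn A (B.erase i₀) (SimplexProduct.eraseEdge T j₀ i₀) := by
      have := (h.flip.eraseEdge hl).flip
      rwa [flip_eraseEdge] at this
    have hl1 : T j₀ i₀ := hl.1
    obtain ⟨hj₀, hi₀⟩ := h.mem _ _ hl1
    have hcard : A.card + (B.erase i₀).card < N := by
      have := card_erase_lt_of_mem hi₀
      omega
    -- The roles are reversed for a right leaf: the deleted edge is marked unless the leaf is the
    -- root.
    by_cases hv₀ : v = Sum.inr i₀
    · obtain ⟨X, hX, h01, hXm⟩ := ih _ hcard hT' (Sum.inl j₀) (by simpa using hj₀) rfl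
      refine ⟨X, fun j i hji => (hX j i hji).1, h01, fun j => ?_, fun i => ?_⟩
      · simp only [hXm.1, deg_eraseEdge hl1 j, hv₀]
        by_cases hj : j = j₀
        · simp [hj, hj₀]
        · simp [hj, Ne.symm hj]
      · simp only [hXm.2, hv₀]
        by_cases hi : i = i₀
        · simp [hi, hi₀]
        · simp [hi, Ne.symm hi]
    · obtain ⟨X, hX, h01, hXm⟩ := ih _ hcard hT' v (by
        rcases v with v | v
        · simpa using hv
        · simp at hv hv₀ ⊢
          exact ⟨hv₀, hv⟩) rfl
      have hX0 : X j₀ i₀ = 0 := by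
        by_contra hh
        exact (hX _ _ hh).2 ⟨rfl, rfl⟩
      refine ⟨fun j i => X j i + if j = j₀ ∧ i = i₀ then 1 else 0, fun j i hji => ?_,
        fun j i => ?_, fun j => ?_, fun i => ?_⟩
      · by_cases hh : j = j₀ ∧ i = i₀
        · rw [hh.1, hh.2]
          exact hl1
        · exact (hX j i (by simpa [hh] using hji)).1
      · by_cases hh : j = j₀ ∧ i = i₀
        · simp [hh.1, hh.2, hX0]
        · simpa [hh] using h01 j i
      · simp only [sum_add_distrib, sum_ite_and_left, hXm.1, deg_eraseEdge hl1 j]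
        by_cases hj : j = j₀
        · simp [hj, hj₀]
          ring
        · simp [hj]
      · simp only [sum_add_distrib, sum_ite_and_right, hXm.2]
        by_cases hi : i = i₀
        · simp [hi, hi₀, hv₀]
        · simp [hi]

/-- Equate the total row and column sums of an orientation rooted at a left vertex. -/
lemma sum_deg (h : TreeOn A B T) (hA : A.Nonempty) : ∑ j, deg T j + 1 = A.card + B.card := by
  obtain ⟨r, hr⟩ := hA
  obtain ⟨X, -, -, hX⟩ := h.exists_orientation (Sum.inl r) (by simpa using hr)
  have := hX.sum_eq
  simp [sum_add_distrib, sum_sub_distrib] at this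
  have h2 : ((∑ j, deg T j + 1 : ℕ) : ℝ) = (A.card + B.card : ℕ) := by
    push_cast
    linarith
  exact_mod_cast h2

end TreeOn

namespace TreeOn

variable {A : Finset ι} {B : Finset κ} {T : ι → κ → Prop}

/-- A spanning tree carries a strictly positive matrix whose margins are determined by the left
degrees of the tree. -/
lemma exists_matrix (h : TreeOn A B T) :
    ∃ Y : ι → κ → ℝ, (∀ j i, 0 ≤ Y j i) ∧ supp Y = T ∧
      HasMargins Y (fun j => A.card * (deg T j - if j ∈ A then 1 else 0) + if j ∈ A then 1 else 0)
        (fun i => if i ∈ B then (A.card : ℝ) else 0) := by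
  -- The matrix sought is the sum of the orientations over all left roots.
  choose X hXT hX01 hX using fun r : A =>
    h.exists_orientation (Sum.inl r.1) (by simp)
  have hX0 : ∀ r j i, 0 ≤ X r j i := fun r j i => by
    rcases hX01 r j i with hh | hh <;> simp [hh]
  -- Rooted at `j`, row `j` has sum `deg T j` with entries at most one, so every edge at `j` is
  -- marked. This gives positivity on all of `T`.
  have hXr : ∀ j (hj : j ∈ A) i, T j i → X ⟨j, hj⟩ j i = 1 := fun j hj i hji => by
    by_contra hne
    have h0 := (hX01 ⟨j, hj⟩ j i).resolve_right hne
    have hlt : ∑ i, X ⟨j, hj⟩ j i < ∑ i, if T j i then (1 : ℝ) else 0 := by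
      refine sum_lt_sum (fun i' _ => ?_) ⟨i, mem_univ _, by simp [h0, hji]⟩
      by_cases hT : T j i'
      · rcases hX01 ⟨j, hj⟩ j i' with hh | hh <;> simp [hh, hT]
      · simp [hT, not_imp_comm.1 (hXT ⟨j, hj⟩ j i') hT]
    rw [(hX ⟨j, hj⟩).1 j] at hlt
    simp [hj, deg] at hlt
  refine ⟨fun j i => ∑ r, X r j i, fun j i => sum_nonneg fun r _ => hX0 r j i, ?_, ?_, ?_⟩
  · funext j i
    refine propext ⟨fun hne => ?_, fun hT => ?_⟩
    · obtain ⟨r, -, hr⟩ := exists_ne_zero_of_sum_ne_zero hne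
      exact hXT r j i hr
    · have hj := (h.mem j i hT).1
      have := single_le_sum (f := fun r => X r j i) (fun r _ => hX0 r j i) (mem_univ ⟨j, hj⟩)
      have h1 := hXr j hj i hT
      rw [h1] at this
      exact (zero_lt_one.trans_le this).ne'
  · intro j
    rw [sum_comm]
    simp_rw [fun r => (hX r).1 j, sum_add_distrib]
    have h1 : ∑ r : A, (if Sum.inl r.1 = (Sum.inl j : ι ⊕ κ) then (1 : ℝ) else 0)
        = if j ∈ A then 1 else 0 := by
      rw [sum_coe_sort A fun r => if Sum.inl r = (Sum.inl j : ι ⊕ κ) then (1 : ℝ) else 0]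
      simp
    rw [h1]
    simp [mul_sub]
  · intro i
    rw [sum_comm]
    simp_rw [fun r => (hX r).2 i]
    simp

end TreeOn

/-! ### Combinatorial triangulations and the degree vectors of their trees. -/

/-- The combinatorial shadow of a triangulation of a product of simplices: a family of bipartite
graphs, closed under subgraphs, such that every nonnegative pair of margins is realised by exactly
one nonnegative matrix with support in the family. -/
structure IsTriangulation (𝓕 : (ι → κ → Prop) → Prop) : Prop where
  mono : ∀ {F G}, 𝓕 F → (∀ j i, G j i → F j i) → 𝓕 G
  unique : ∀ {M N : ι → κ → ℝ} {x y}, (∀ j i, 0 ≤ M j i) → (∀ j i, 0 ≤ N j i) → 𝓕 (supp M) →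
    𝓕 (supp N) → HasMargins M x y → HasMargins N x y → M = N
  exists_matrix : ∀ (x : ι → ℝ) (y : κ → ℝ), (∀ j, 0 ≤ x j) → (∀ i, 0 ≤ y i) →
    ∑ j, x j = ∑ i, y i → ∃ M : ι → κ → ℝ, (∀ j i, 0 ≤ M j i) ∧ 𝓕 (supp M) ∧ HasMargins M x y

/-- The spanning trees on `A` and `B` in a family of bipartite graphs. -/
def IsTree (𝓕 : (ι → κ → Prop) → Prop) (A : Finset ι) (B : Finset κ) (T : ι → κ → Prop) : Prop :=
  𝓕 T ∧ TreeOn A B T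

/-- The family of transposed graphs. -/
def flipFamily (𝓕 : (ι → κ → Prop) → Prop) : (κ → ι → Prop) → Prop := fun F => 𝓕 (flip F)

protected lemma IsTree.flip {𝓕 : (ι → κ → Prop) → Prop} {A : Finset ι} {B : Finset κ}
    {T : ι → κ → Prop} (h : IsTree 𝓕 A B T) : IsTree (flipFamily 𝓕) B A (flip T) :=
  ⟨h.1, h.2.flip⟩

namespace IsTriangulation

variable {𝓕 : (ι → κ → Prop) → Prop} {A : Finset ι} {B : Finset κ} {T T' : ι → κ → Prop}

protected lemma flip (h : IsTriangulation 𝓕) : IsTriangulation (flipFamily 𝓕) where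
  mono hF hGF := h.mono hF fun j i hG => hGF i j hG
  unique {M N _ _} hM hN hFM hFN hMx hNx := by
    have := h.unique (M := flip M) (N := flip N) (fun j i => hM i j) (fun j i => hN i j) hFM hFN
      hMx.flip hNx.flip
    funext i j
    exact congrFun (congrFun this j) i
  exists_matrix x y hx hy hxy := by
    obtain ⟨M, hM, hF, hMx⟩ := h.exists_matrix y x hy hx hxy.symm
    exact ⟨flip M, fun i j => hM j i, hF, hMx.flip⟩

/-- The positive and negative parts of a matrix with zero margins have equal margins, so uniqueness
makes them coincide. -/
lemma acyclic (h : IsTriangulation 𝓕) {F : ι → κ → Prop} (hF : 𝓕 F) : Acyclic F := by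
  intro M hM hM0
  have hsub : (fun j i => (M j i)⁺) - (fun j i => (M j i)⁻) = M := by
    funext j i
    exact posPart_sub_negPart _
  have := h.unique (M := fun j i => (M j i)⁺) (N := fun j i => (M j i)⁻)
    (x := fun j => ∑ i, (M j i)⁺) (y := fun i => ∑ j, (M j i)⁺)
    (fun j i => posPart_nonneg _) (fun j i => negPart_nonneg _)
    (h.mono hF fun j i hji => hM j i fun h0 => hji (by simp [h0]))
    (h.mono hF fun j i hji => hM j i fun h0 => hji (by simp [h0]))
    ⟨fun _ => rfl, fun _ => rfl⟩
    ⟨fun j => ?_, fun i => ?_⟩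
  · rw [← hsub, this, sub_self]
  · have := hM0.1 j
    rw [← hsub] at this
    simp only [Pi.sub_apply, sum_sub_distrib, Pi.zero_apply] at this
    linarith
  · have := hM0.2 i
    rw [← hsub] at this
    simp only [Pi.sub_apply, sum_sub_distrib, Pi.zero_apply] at this
    linarith

/-- A matrix whose margins are generic modulo `|A|` is supported on a spanning tree. -/
lemma treeOn_supp (h : IsTriangulation 𝓕) (hA : A.Nonempty) {M : ι → κ → ℝ}
    (hM : ∀ j i, 0 ≤ M j i) (hF : 𝓕 (supp M)) {z : ι → ℕ} {w : κ → ℕ}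
    (hx : HasMargins M (fun j => if j ∈ A then (A.card * z j + 1 : ℝ) else 0)
      (fun i => if i ∈ B then (A.card * (w i + 1) : ℝ) else 0)) : TreeOn A B (supp M) where
  mem j i hji := by
    have hpos : 0 < M j i := lt_of_le_of_ne (hM j i) (Ne.symm hji)
    constructor
    · by_contra hj
      have h1 := hx.1 j
      simp only [if_neg hj] at h1
      exact hji ((sum_eq_zero_iff_of_nonneg fun i _ => hM j i).1 h1 i (mem_univ _))
    · by_contra hi
      have h1 := hx.2 i
      simp only [if_neg hi] at h1
      exact hji ((sum_eq_zero_iff_of_nonneg fun j _ => hM j i).1 h1 j (mem_univ _))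
  acyclic := h.acyclic hF
  connected A' hA' B' hB' hAB := by
    -- No edge leaves `A' ∪ B'`, so its rows and columns carry the same mass. Modulo `|A|` this
    -- reads `|A'| ≡ 0`, forcing `A'` to be empty or all of `A`.
    have hsum : ∑ j ∈ A', ∑ i, M j i = ∑ i ∈ B', ∑ j, M j i := by
      have e1 : ∑ j ∈ A', ∑ i, M j i = ∑ j, ∑ i, if j ∈ A' then M j i else 0 := by
        simp only [sum_ite_irrel, sum_const_zero, ← sum_filter, filter_mem_eq_inter, univ_inter]
      have e2 : ∑ i ∈ B', ∑ j, M j i = ∑ i, ∑ j, if i ∈ B' then M j i else 0 := by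
        simp only [sum_ite_irrel, sum_const_zero, ← sum_filter, filter_mem_eq_inter, univ_inter]
      rw [e1, e2, sum_comm]
      refine sum_congr rfl fun i _ => sum_congr rfl fun j _ => ?_
      by_cases h0 : M j i = 0
      · simp [h0]
      · simp [hAB j i h0]
    simp_rw [hx.1, hx.2] at hsum
    rw [sum_congr rfl fun j hj => if_pos (hA' hj), sum_congr rfl fun i hi => if_pos (hB' hi)]
      at hsum
    have hnat : A.card * ∑ j ∈ A', z j + A'.card = A.card * ∑ i ∈ B', (w i + 1) := by
      rw [sum_add_distrib, ← mul_sum, ← mul_sum] at hsum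
      simp only [sum_const, nsmul_eq_mul, mul_one] at hsum
      exact_mod_cast hsum
    have hdvd : A.card ∣ A'.card := by
      rw [← Nat.dvd_add_right (Dvd.intro _ rfl : A.card ∣ A.card * ∑ j ∈ A', z j), hnat]
      exact Dvd.intro _ rfl
    have hApos : 0 < A.card := hA.card_pos
    by_cases h0 : A'.card = 0
    · left
      have hA0 := card_eq_zero.1 h0
      subst hA0
      refine ⟨rfl, ?_⟩
      simp only [sum_empty, card_empty] at hnat
      have : ∑ i ∈ B', (w i + 1) = 0 := by
        rcases Nat.mul_eq_zero.1 (show A.card * ∑ i ∈ B', (w i + 1) = 0 by omega) with h' | h'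
        · omega
        · exact h'
      rw [sum_eq_zero_iff] at this
      exact eq_empty_of_forall_notMem fun i hi => by simpa using this i hi
    · right
      have hAA : A' = A := eq_of_subset_of_card_le hA' (Nat.le_of_dvd (by omega) hdvd)
      refine ⟨hAA, ?_⟩
      have htot := hx.sum_eq
      simp only [← sum_filter, filter_mem_eq_inter, univ_inter] at htot
      rw [hAA, htot] at hsum
      by_contra hne
      obtain ⟨i, hi, hi'⟩ := exists_of_ssubset (ssubset_of_subset_of_ne hB' hne)
      have := sum_lt_sum_of_subset (f := fun i => (A.card * (w i + 1) : ℝ)) hB' hi hi'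
        (by positivity) (fun i _ _ => by positivity)
      exact this.ne hsum.symm

/-- Trees in a triangulation are determined by their left degrees. -/
lemma tree_unique (h : IsTriangulation 𝓕) (hT : IsTree 𝓕 A B T) (hT' : IsTree 𝓕 A B T')
    (hd : deg T = deg T') : T = T' := by
  -- The margins of these matrices depend only on the left degrees, and the supports recover the
  -- trees.
  obtain ⟨Y, hY, hYT, hYm⟩ := hT.2.exists_matrix
  obtain ⟨Y', hY', hYT', hYm'⟩ := hT'.2.exists_matrix
  rw [← hd] at hYm'
  rw [← hYT, ← hYT', h.unique hY hY' (hYT ▸ hT.1) (hYT' ▸ hT'.1) hYm hYm']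

/-- Every admissible left degree vector is the degree vector of a tree. -/
lemma exists_tree (h : IsTriangulation 𝓕) (hA : A.Nonempty) (hB : B.Nonempty) {l : ι → ℕ}
    (hl : ∀ j, l j ≠ 0 ↔ j ∈ A) (hs : ∑ j, l j + 1 = A.card + B.card) :
    ∃ T, IsTree 𝓕 A B T ∧ deg T = l := by
  have hApos : 0 < A.card := hA.card_pos
  -- These are the margins that `TreeOn.exists_matrix` would give for a tree with left degrees `l`.
  have hxy : ∑ j, (if j ∈ A then (A.card * (l j - 1 : ℕ) + 1 : ℝ) else 0) =
      ∑ i, if i ∈ B then (A.card * ((0 : ℕ) + 1) : ℝ) else 0 := by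
    simp only [← sum_filter, filter_mem_eq_inter, univ_inter]
    have h1 : ∑ j ∈ A, (l j - 1) + A.card = ∑ j, l j := by
      rw [card_eq_sum_ones, ← sum_add_distrib, ← sum_subset (subset_univ A) fun j _ hj =>
        by_contra fun hh => hj ((hl j).1 hh)]
      exact sum_congr rfl fun j hj => Nat.sub_add_cancel (Nat.pos_of_ne_zero ((hl j).2 hj))
    have h2 : ∑ j ∈ A, (l j - 1) + 1 = B.card := by omega
    rw [sum_add_distrib, ← mul_sum]
    simp only [sum_const, nsmul_eq_mul, mul_one, ← h2]
    push_cast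
    ring
  obtain ⟨M, hM, hFM, hMx⟩ := h.exists_matrix _ _
    (fun j => by split_ifs <;> positivity) (fun i => by split_ifs <;> positivity) hxy
  have hT := h.treeOn_supp hA hM hFM hMx
  refine ⟨supp M, ⟨hFM, hT⟩, ?_⟩
  obtain ⟨Y, hY, hYM, hYx⟩ := hT.exists_matrix
  have hsY : SuppIn Y (supp M) := fun j i hji => by rw [← hYM]; exact hji
  have hMle : ∀ j i, M j i ≤ A.card := fun j i => by
    have h1 := single_le_sum (f := fun j => M j i) (fun j _ => hM j i) (mem_univ j)
    simp only [hMx.2 i] at h1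
    refine h1.trans ?_
    split_ifs <;> simp
  have hYle : ∀ j i, Y j i ≤ A.card := fun j i => by
    have h1 := single_le_sum (f := fun j => Y j i) (fun j _ => hY j i) (mem_univ j)
    simp only [hYx.2 i] at h1
    refine h1.trans ?_
    split_ifs <;> simp
  have hrow : ∀ j, ∑ i, (M - Y) j i = ((l j : ℤ) - deg (supp M) j : ℤ) * A.card := fun j => by
    rw [(hMx.sub hYx).1]
    by_cases hj : j ∈ A
    · have := Nat.pos_of_ne_zero ((hl j).2 hj)
      simp [hj, Nat.cast_sub (show 1 ≤ l j from this)]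
      ring
    · have h1 : l j = 0 := by_contra fun hh => hj ((hl j).1 hh)
      have h2 : deg (supp M) j = 0 := by_contra fun hh => hj ((hT.deg_ne_zero_iff hB j).1 hh)
      simp [hj, h1, h2]
  have hcol : ∀ i, ∑ j, (M - Y) j i = 0 := fun i => by
    rw [(hMx.sub hYx).2]
    simp
  -- The margins of `M - Y` are multiples of `|A|`, hence so are its entries; but on the tree both
  -- matrices have entries in `(0, |A|]`.
  have hMY : M - Y = 0 := by
    funext j i
    have hmem := hT.acyclic.mem_addSubgroup (AddSubgroup.zmultiples (A.card : ℝ)) (M := M - Y)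
      (fun j i hji => by
        by_contra hF
        exact hji (by simp [not_imp_comm.1 (hsY j i) hF, not_not.1 hF]))
      (fun j => by rw [hrow, ← zsmul_eq_mul]; exact AddSubgroup.zsmul_mem_zmultiples _ _)
      (fun i => by rw [hcol]; exact zero_mem _) j i
    obtain ⟨k, hk⟩ := AddSubgroup.mem_zmultiples_iff.1 hmem
    have hAr : (0 : ℝ) < A.card := by exact_mod_cast hApos
    by_cases h0 : M j i = 0
    · have : Y j i = 0 := not_imp_comm.1 (hsY j i) (not_not.2 h0)
      simp [h0, this]
    · have hYpos : 0 < Y j i := lt_of_le_of_ne (hY j i) (Ne.symm (by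
        change supp Y j i
        rw [hYM]
        exact h0))
      have hMpos : 0 < M j i := lt_of_le_of_ne (hM j i) (Ne.symm h0)
      have h1 := hMle j i
      have h2 := hYle j i
      simp only [Pi.sub_apply, zsmul_eq_mul] at hk
      have hk1 : (k : ℝ) < 1 := by
        by_contra! hc
        nlinarith
      have hk2 : (-1 : ℝ) < k := by
        by_contra! hc
        nlinarith
      have hk0 : k = 0 := by
        have a1 : k < 1 := by exact_mod_cast hk1
        have a2 : -1 < k := by exact_mod_cast hk2
        omega
      simp only [Pi.sub_apply, Pi.zero_apply, ← hk, hk0]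
      simp
  funext j
  have := hrow j
  simp only [hMY, Pi.zero_apply, sum_const_zero] at this
  have h3 := (mul_eq_zero.1 this.symm).resolve_right (by exact_mod_cast hApos.ne')
  have h4 : (l j : ℤ) - deg (supp M) j = 0 := by exact_mod_cast h3
  omega

/-- Two trees with a common left leaf whose right degrees differ by an exchange attach that leaf
to the same vertex. -/
lemma leaf_eq (h : IsTriangulation 𝓕) (hT : IsTree 𝓕 A B T) (hT' : IsTree 𝓕 A B T') {j₀ : ι}
    {i i' k k' : κ} (hi : IsLeaf T j₀ i) (hi' : IsLeaf T' j₀ i') (hk : k ∈ B) (hk' : k' ∈ B)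
    (hd : ∀ c, deg (flip T) c + (if c = k then 1 else 0) =
      deg (flip T') c + if c = k' then 1 else 0) : i = i' := by
  obtain ⟨X, hXT, hX01, hX⟩ := hT.2.flip.exists_orientation (Sum.inl k) (by simpa using hk)
  obtain ⟨X', hXT', hX01', hX'⟩ := hT'.2.flip.exists_orientation (Sum.inl k') (by simpa using hk')
  -- The hypothesis on degrees says exactly that the orientations rooted at `k` and `k'` have the
  -- same margins.
  have hXX : X = X' := by
    refine h.flip.unique (x := fun c => deg (flip T) c - (if c ∈ B then 1 else 0) +
        if (Sum.inl k : κ ⊕ ι) = Sum.inl c then 1 else 0) (fun c j => ?_) (fun c j => ?_)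
        (h.flip.mono hT.flip.1 hXT) (h.flip.mono hT'.flip.1 hXT') hX ⟨fun c => ?_, hX'.2⟩
    · rcases hX01 c j with hh | hh <;> simp [hh]
    · rcases hX01' c j with hh | hh <;> simp [hh]
    · rw [hX'.1]
      have : (deg (flip T) c : ℝ) + (if c = k then 1 else 0) =
          deg (flip T') c + if c = k' then 1 else 0 := by
        exact_mod_cast hd c
      simp only [Sum.inl.injEq, eq_comm (a := k), eq_comm (a := k')]
      linarith
  have hj₀ : j₀ ∈ A := (hT.2.mem _ _ hi.1).1
  have h1 := hX.2 j₀
  rw [sum_eq_single i (fun c _ hc => not_imp_comm.1 (hXT c j₀) fun hF => hc (hi.2 c hF))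
    (by simp)] at h1
  simp only [hj₀, if_true, reduceCtorEq, if_false, sub_zero] at h1
  -- The leaf owns its only edge, so that edge is marked in the common matrix and lies in `T'` too.
  exact hi'.2 i (hXT' i j₀ (by rw [← hXX, h1]; exact one_ne_zero))

/-- Every member of a triangulation extends to a spanning tree. -/
lemma exists_tree_ge [Nonempty ι] [Nonempty κ] (h : IsTriangulation 𝓕) {F : ι → κ → Prop}
    (hF : 𝓕 F) : ∃ T, IsTree 𝓕 univ univ T ∧ ∀ j i, F j i → T j i := by
  set n : ℕ := (univ : Finset ι).card with hn
  set I : ι → κ → ℝ := fun j i => if F j i then 1 else 0 with hI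
  have hIm : HasMargins I (fun j => (deg F j : ℝ)) (fun i => (deg (flip F) i : ℝ)) :=
    ⟨fun j => by simp [hI, deg], fun i => by
      simp only [deg, Nat.cast_sum]
      refine sum_congr rfl fun j _ => ?_
      by_cases hji : F j i <;> simp [hI, flip, hji]⟩
  have hI0 : ∀ j i, 0 ≤ I j i := fun j i => by
    simp only [hI]
    split_ifs <;> simp
  have hIs : supp I = F := by
    funext j i
    simp [supp, hI]
  have j₁ : ι := Classical.arbitrary ι
  -- This correction in a single row balances the generic perturbation.
  let a : ι → ℕ := fun j => if j = j₁ then Fintype.card κ - 1 else 0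
  have hκ : 1 ≤ Fintype.card κ := Fintype.card_pos
  have hasum : ∑ j, (n * (a j : ℝ) + 1) = n * Fintype.card κ := by
    rw [sum_add_distrib, ← mul_sum]
    simp [a, Nat.cast_sub hκ, hn]
    ring
  have hdeg : ∑ j, (deg F j : ℝ) = ∑ i, (deg (flip F) i : ℝ) := hIm.sum_eq
  -- Perturb `n * k` times the margins of `I` by a fixed amount, so that the support is a tree for
  -- each `k`; some tree `T` then occurs infinitely often.
  have hex : ∀ k : ℕ, ∃ M : ι → κ → ℝ, (∀ j i, 0 ≤ M j i) ∧ 𝓕 (supp M) ∧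
      HasMargins M (fun j => n * (k * deg F j + a j : ℕ) + 1)
        (fun i => n * ((k * deg (flip F) i : ℕ) + 1)) := fun k => by
    refine h.exists_matrix _ _ (fun j => by positivity) (fun i => by positivity) ?_
    have e1 : ∑ j, ((n : ℝ) * (k * deg F j + a j : ℕ) + 1) =
        n * k * ∑ j, (deg F j : ℝ) + ∑ j, (n * (a j : ℝ) + 1) := by
      rw [mul_sum, ← sum_add_distrib]
      exact sum_congr rfl fun j _ => by push_cast; ring
    have e2 : ∑ i, ((n : ℝ) * ((k * deg (flip F) i : ℕ) + 1)) =
        n * k * ∑ i, (deg (flip F) i : ℝ) + n * Fintype.card κ := by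
      have e3 : (n : ℝ) * Fintype.card κ = ∑ _i : κ, (n : ℝ) := by simp [mul_comm]
      rw [e3, mul_sum, ← sum_add_distrib]
      exact sum_congr rfl fun j _ => by push_cast; ring
    rw [e1, e2, hdeg, hasum]
  choose M hM hFM hMx using hex
  have hTree : ∀ k, TreeOn univ univ (supp (M k)) := fun k =>
    h.treeOn_supp univ_nonempty (hM k) (hFM k) (z := fun j => k * deg F j + a j)
      (w := fun i => k * deg (flip F) i) (by simpa [hn] using hMx k)
  obtain ⟨T, hT⟩ := Finite.exists_infinite_fiber fun k => supp (M k)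
  have hinf : Set.Infinite ((fun k => supp (M k)) ⁻¹' {T}) := Set.infinite_coe_iff.1 hT
  obtain ⟨k₁, hk₁⟩ := hinf.nonempty
  obtain ⟨k₂, hk₂, hlt⟩ := hinf.exists_gt k₁
  have hk₁T : supp (M k₁) = T := hk₁
  have hk₂T : supp (M k₂) = T := hk₂
  have hTr : IsTree 𝓕 univ univ T := hk₁T ▸ ⟨hFM k₁, hTree k₁⟩
  have hMT : ∀ k, supp (M k) = T → SuppIn (M k) T := fun k hk j i hji => hk ▸ hji
  have hnpos : (0 : ℝ) < n := by
    rw [hn]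
    exact_mod_cast card_pos.2 (univ_nonempty (α := ι))
  have hc : (k₂ - k₁ : ℝ) ≠ 0 := (sub_pos.2 (by exact_mod_cast hlt)).ne'
  -- On the indices sharing `T`, the matrix `M k` is affine in `k` with slope `n • M₀`, and `M₀` has
  -- the margins of `I`.
  set M₀ : ι → κ → ℝ := (n * (k₂ - k₁) : ℝ)⁻¹ • (M k₂ - M k₁) with hM₀
  have hM₀T : SuppIn M₀ T := fun j i hji => by
    by_contra hF
    exact hji (by simp [hM₀, not_imp_comm.1 (hMT _ hk₁T j i) hF,
      not_imp_comm.1 (hMT _ hk₂T j i) hF])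
  have hM₀m : HasMargins M₀ (fun j => (deg F j : ℝ)) (fun i => (deg (flip F) i : ℝ)) := by
    convert! ((hMx k₂).sub (hMx k₁)).smul (n * (k₂ - k₁) : ℝ)⁻¹ using 1
    · funext j
      simp only [Pi.smul_apply, Pi.sub_apply, smul_eq_mul]
      push_cast
      field_simp
      ring
    · funext j
      simp only [Pi.smul_apply, Pi.sub_apply, smul_eq_mul]
      push_cast
      field_simp
      ring
  have hconst : ∀ k, supp (M k) = T → M k - (n * k : ℝ) • M₀ = M k₁ - (n * k₁ : ℝ) • M₀ := by
    have hs : ∀ k, supp (M k) = T → SuppIn (M k - (n * k : ℝ) • M₀) T := fun k hk j i hji => by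
      by_contra hF
      exact hji (by simp [not_imp_comm.1 (hMT _ hk j i) hF, not_imp_comm.1 (hM₀T j i) hF])
    have hm : ∀ k, HasMargins (M k - (n * k : ℝ) • M₀) (fun j => n * (a j : ℝ) + 1)
        (fun _ => (n : ℝ)) := fun k => by
      convert! (hMx k).sub (hM₀m.smul (n * k : ℝ)) using 1
      · funext j
        simp only [Pi.smul_apply, Pi.sub_apply, smul_eq_mul]
        push_cast
        ring
      · funext j
        simp only [Pi.smul_apply, Pi.sub_apply, smul_eq_mul]
        push_cast
        ring
    exact fun k hk => hTr.2.acyclic.eq_of_hasMargins (hs k hk) (hs k₁ hk₁T) (hm k) (hm k₁)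
  -- A negative entry of the slope would make `M k` negative for some large `k`.
  have hM₀0 : ∀ j i, 0 ≤ M₀ j i := fun j i => by
    by_contra! hneg
    obtain ⟨m, hm⟩ := exists_nat_gt ((M k₁ - (n * k₁ : ℝ) • M₀) j i / (-(n * M₀ j i)))
    obtain ⟨k, hk, hmk⟩ := hinf.exists_gt m
    have hkT : supp (M k) = T := hk
    have h1 := congrFun (congrFun (hconst k hkT) j) i
    have h2 := hM k j i
    have hpos : 0 < -(n * M₀ j i) := by nlinarith
    rw [div_lt_iff₀ hpos, ← h1] at hm
    simp only [Pi.sub_apply, Pi.smul_apply, smul_eq_mul] at hm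
    have hmk' : (m : ℝ) < k := by exact_mod_cast hmk
    nlinarith
  have hIM : I = M₀ := h.unique hI0 hM₀0 (hIs ▸ hF) (h.mono hTr.1 hM₀T) hIm hM₀m
  refine ⟨T, hTr, fun j i hji => hM₀T j i ?_⟩
  rw [← hIM]
  simp [hI, hji]

end IsTriangulation

/-! ### Degree pairs determine the triangulation. -/

/-- The pairs of left and right degree vectors of the spanning trees on `A` and `B`. -/
def degreePairs (𝓕 : (ι → κ → Prop) → Prop) (A : Finset ι) (B : Finset κ) :
    Set ((ι → ℕ) × (κ → ℕ)) :=
  {p | ∃ T, IsTree 𝓕 A B T ∧ deg T = p.1 ∧ deg (flip T) = p.2}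

lemma degreePairs_flip (𝓕 : (ι → κ → Prop) → Prop) (A : Finset ι) (B : Finset κ) :
    degreePairs (flipFamily 𝓕) B A = Prod.swap ⁻¹' degreePairs 𝓕 A B := by
  ext ⟨r, l⟩
  exact ⟨fun ⟨T, hT, h1, h2⟩ => ⟨flip T, hT.flip, h2, h1⟩,
    fun ⟨T, hT, h1, h2⟩ => ⟨flip T, hT.flip, h2, h1⟩⟩

namespace IsTriangulation

variable {𝓕 𝓖 : (ι → κ → Prop) → Prop} {A : Finset ι} {B : Finset κ} {T T' : ι → κ → Prop}

lemma eraseEdge (h : IsTriangulation 𝓕) (hT : IsTree 𝓕 A B T) {j₀ : ι} {i₀ : κ}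
    (hl : IsLeaf T j₀ i₀) : IsTree 𝓕 (A.erase j₀) B (eraseEdge T j₀ i₀) :=
  ⟨h.mono hT.1 fun _ _ hji => hji.1, hT.2.eraseEdge hl⟩

/-- Trees in a triangulation are determined by their right degrees. -/
lemma tree_unique_flip (h : IsTriangulation 𝓕) (hT : IsTree 𝓕 A B T) (hT' : IsTree 𝓕 A B T')
    (hd : deg (flip T) = deg (flip T')) : T = T' := by
  have := h.flip.tree_unique hT.flip hT'.flip hd
  exact congrArg flip this

/-- Every admissible right degree vector is the degree vector of a tree. -/
lemma exists_tree_flip (h : IsTriangulation 𝓕) (hA : A.Nonempty) (hB : B.Nonempty) {r : κ → ℕ}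
    (hr : ∀ i, r i ≠ 0 ↔ i ∈ B) (hs : ∑ i, r i + 1 = A.card + B.card) :
    ∃ T, IsTree 𝓕 A B T ∧ deg (flip T) = r := by
  obtain ⟨T, hT, hd⟩ := h.flip.exists_tree hB hA hr (by rw [hs, add_comm])
  exact ⟨flip T, hT.flip, hd⟩

/-- A leaf can be attached at a new left vertex. -/
lemma exists_attach (h : IsTriangulation 𝓕) {j₀ : ι} (hj₀ : j₀ ∈ A) (hA : (A.erase j₀).Nonempty)
    (hB : B.Nonempty) {S : ι → κ → Prop} (hS : IsTree 𝓕 (A.erase j₀) B S) :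
    ∃ T i, IsTree 𝓕 A B T ∧ IsLeaf T j₀ i ∧ SimplexProduct.eraseEdge T j₀ i = S := by
  have hS0 : deg S j₀ = 0 := by
    by_contra hne
    simpa using (hS.2.deg_ne_zero_iff hB j₀).1 hne
  -- Ask for degree one at `j₀` and the degrees of `S` elsewhere; deleting the leaf then returns `S`
  -- by uniqueness.
  obtain ⟨T, hT, hd⟩ := h.exists_tree (A := A) ⟨j₀, hj₀⟩ hB
    (l := fun j => deg S j + if j = j₀ then 1 else 0) (fun j => by
      by_cases hj : j = j₀
      · simp [hj, hj₀]
      · simpa [hj] using hS.2.deg_ne_zero_iff hB j) (by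
      have h1 := hS.2.sum_deg hA
      have h2 := card_erase_add_one hj₀
      simp only [sum_add_distrib, sum_ite_eq', mem_univ, if_true]
      omega)
  obtain ⟨i, hi⟩ := deg_eq_one_iff.1 (show deg T j₀ = 1 by simp [hd, hS0])
  refine ⟨T, i, hT, hi, h.tree_unique (h.eraseEdge hT hi) hS ?_⟩
  funext j
  have h1 := deg_eraseEdge hi.1 j
  have h2 := congrFun hd j
  omega

/-- If two triangulations have the same degree pairs, then trees with the same degrees agree at
their left leaves. -/
lemma leaf_eq_of_degreePairs_eq (h : IsTriangulation 𝓕) (h' : IsTriangulation 𝓖)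
    (hP : degreePairs 𝓕 A B = degreePairs 𝓖 A B) {j₀ : ι} (hA : (A.erase j₀).Nonempty)
    (hT : IsTree 𝓕 A B T) (hT' : IsTree 𝓖 A B T') {i i' : κ} (hi : IsLeaf T j₀ i)
    (hi' : IsLeaf T' j₀ i') (hd : deg T = deg T') (hr : deg (flip T) = deg (flip T')) :
    i = i' := by
  by_contra hne
  -- Among counterexamples attached at `i`, take one with the right degree of `i` maximal.
  let Bad : Set (ι → κ → Prop) := {T | IsTree 𝓕 A B T ∧ IsLeaf T j₀ i ∧ ∃ T' i', IsTree 𝓖 A B T' ∧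
    IsLeaf T' j₀ i' ∧ deg T = deg T' ∧ deg (flip T) = deg (flip T') ∧ i ≠ i'}
  obtain ⟨T₁, ⟨hT₁, hi₁, T₁', i₁', hT₁', hi₁', hd₁, hr₁, hne₁⟩, hmax⟩ :=
    (Set.toFinite Bad).exists_maximalFor (fun T => deg (flip T) i) Bad
      ⟨T, hT, hi, T', i', hT', hi', hd, hr, hne⟩
  have hj₀ : j₀ ∈ A := (hT.2.mem _ _ hi.1).1
  have hiB : i ∈ B := (hT.2.mem _ _ hi.1).2
  have hi₁B : i₁' ∈ B := (hT₁'.2.mem _ _ hi₁'.1).2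
  have hB : B.Nonempty := ⟨i, hiB⟩
  have hS' := h'.eraseEdge hT₁' hi₁'
  -- Transfer `T₁'` minus its leaf to `𝓕` by right degrees and reattach the leaf. The result `T₂`
  -- differs from `T₁` by an exchange of right degrees, so `leaf_eq` attaches it at `i` and the
  -- degree of `i` grows by one.
  obtain ⟨S, hS, hSr⟩ := h.exists_tree_flip hA hB (fun c => hS'.2.flip.deg_ne_zero_iff hA c)
    (by rw [hS'.2.flip.sum_deg hB, add_comm])
  obtain ⟨T₂, i₂, hT₂, hi₂, rfl⟩ := h.exists_attach hj₀ hA hB hS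
  have hx : ∀ c, deg (flip T₂) c + (if c = i₁' then 1 else 0) =
      deg (flip T₁) c + if c = i₂ then 1 else 0 := fun c => by
    have e1 := deg_flip_eraseEdge (F := T₂) hi₂.1 c
    have e2 := deg_flip_eraseEdge (F := T₁') hi₁'.1 c
    have e3 := congrFun hSr c
    have e4 := congrFun hr₁ c
    omega
  have hi₂B : i₂ ∈ B := (hT₂.2.mem _ _ hi₂.1).2
  obtain rfl : i₂ = i := h.leaf_eq hT₂ hT₁ hi₂ hi₁ hi₁B hi₂B hx
  have hlt : deg (flip T₂) i₂ = deg (flip T₁) i₂ + 1 := by simpa [hne₁] using hx i₂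
  obtain ⟨T₂', hT₂', hd₂, hr₂⟩ : (deg T₂, deg (flip T₂)) ∈ degreePairs 𝓖 A B :=
    hP ▸ ⟨T₂, hT₂, rfl, rfl⟩
  simp only at hd₂ hr₂
  obtain ⟨i₂', hi₂'⟩ := deg_eq_one_iff.1 (show deg T₂' j₀ = 1 by
    rw [hd₂]
    exact deg_eq_one_iff.2 ⟨_, hi₂⟩)
  -- By maximality `T₂` is not a counterexample.
  obtain rfl : i₂ = i₂' := by
    by_contra hne₂
    have := hmax (j := T₂) ⟨hT₂, hi₂, T₂', i₂', hT₂', hi₂', hd₂.symm, hr₂.symm, hne₂⟩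
      (by simp only; omega)
    simp only at this
    omega
  -- Without the leaf both trees have the same right degrees. With it they have the same left
  -- degrees, hence coincide, although their right degrees at `i₂` differ.
  have hE : SimplexProduct.eraseEdge T₂' j₀ i₂ = SimplexProduct.eraseEdge T₁' j₀ i₁' := by
    refine h'.tree_unique_flip (h'.eraseEdge hT₂' hi₂') hS' ?_
    funext c
    have e1 := deg_flip_eraseEdge (F := T₂) hi₂.1 c
    have e2 := deg_flip_eraseEdge (F := T₂') hi₂'.1 c
    have e3 := congrFun hSr c
    have e4 := congrFun hr₂ c
    omega
  have hTT : T₂' = T₁' := by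
    refine h'.tree_unique hT₂' hT₁' ?_
    funext j
    have e1 := deg_eraseEdge hi₂'.1 j
    have e2 := deg_eraseEdge hi₁'.1 j
    rw [e1, e2, hE]
  have e1 := congrFun hr₁ i₂
  have e2 := congrFun hr₂ i₂
  rw [hTT] at e2
  omega

/-- Attach `j₀` as a leaf, pass to the tree of `𝓖` with the same degrees, and delete the leaf: it
hangs at the same vertex, so both degree vectors drop equally. -/
lemma degreePairs_erase_subset (h : IsTriangulation 𝓕) (h' : IsTriangulation 𝓖)
    (hP : degreePairs 𝓕 A B = degreePairs 𝓖 A B) {j₀ : ι} (hj₀ : j₀ ∈ A)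
    (hA : (A.erase j₀).Nonempty) (hB : B.Nonempty) :
    degreePairs 𝓕 (A.erase j₀) B ⊆ degreePairs 𝓖 (A.erase j₀) B := by
  rintro ⟨l, r⟩ ⟨S, hS, rfl, rfl⟩
  obtain ⟨T, i, hT, hi, rfl⟩ := h.exists_attach hj₀ hA hB hS
  obtain ⟨T', hT', hd, hr⟩ : (deg T, deg (flip T)) ∈ degreePairs 𝓖 A B := hP ▸ ⟨T, hT, rfl, rfl⟩
  simp only at hd hr
  obtain ⟨i', hi'⟩ := deg_eq_one_iff.1 (show deg T' j₀ = 1 by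
    rw [hd]
    exact deg_eq_one_iff.2 ⟨_, hi⟩)
  obtain rfl := h.leaf_eq_of_degreePairs_eq h' hP hA hT hT' hi hi' hd.symm hr.symm
  refine ⟨_, h'.eraseEdge hT' hi', funext fun j => ?_, funext fun c => ?_⟩
  · have e1 := deg_eraseEdge hi.1 j
    have e2 := deg_eraseEdge hi'.1 j
    have e3 := congrFun hd j
    simp only
    omega
  · have e1 := deg_flip_eraseEdge (F := T) hi.1 c
    have e2 := deg_flip_eraseEdge (F := T') hi'.1 c
    have e3 := congrFun hr c
    simp only
    omega

/-- The inductive step for a left leaf; transposition supplies the right leaf case. -/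
lemma isTree_of_leaf (h : IsTriangulation 𝓕) (h' : IsTriangulation 𝓖)
    (hP : degreePairs 𝓕 A B = degreePairs 𝓖 A B) {j₀ : ι} (hA : (A.erase j₀).Nonempty)
    (ih : degreePairs 𝓕 (A.erase j₀) B = degreePairs 𝓖 (A.erase j₀) B →
      ∀ S, IsTree 𝓕 (A.erase j₀) B S → IsTree 𝓖 (A.erase j₀) B S)
    (hT : IsTree 𝓕 A B T) {i : κ} (hi : IsLeaf T j₀ i) : IsTree 𝓖 A B T := by
  have hj₀ : j₀ ∈ A := (hT.2.mem _ _ hi.1).1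
  have hB : B.Nonempty := ⟨i, (hT.2.mem _ _ hi.1).2⟩
  obtain ⟨T', hT', hd, hr⟩ : (deg T, deg (flip T)) ∈ degreePairs 𝓖 A B := hP ▸ ⟨T, hT, rfl, rfl⟩
  simp only at hd hr
  obtain ⟨i', hi'⟩ := deg_eq_one_iff.1 (show deg T' j₀ = 1 by
    rw [hd]
    exact deg_eq_one_iff.2 ⟨_, hi⟩)
  obtain rfl := h.leaf_eq_of_degreePairs_eq h' hP hA hT hT' hi hi' hd.symm hr.symm
  have hS := ih ((h.degreePairs_erase_subset h' hP hj₀ hA hB).antisymm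
    (h'.degreePairs_erase_subset h hP.symm hj₀ hA hB)) _ (h.eraseEdge hT hi)
  have hE := h'.tree_unique hS (h'.eraseEdge hT' hi') (funext fun j => by
    have e1 := deg_eraseEdge hi.1 j
    have e2 := deg_eraseEdge hi'.1 j
    have e3 := congrFun hd j
    omega)
  rw [eq_of_eraseEdge_eq hi.1 hi'.1 hE]
  exact hT'

/-- The degree pairs determine the spanning trees of a triangulation. -/
lemma isTree_of_degreePairs_eq (h : IsTriangulation 𝓕) (h' : IsTriangulation 𝓖)
    (hA : A.Nonempty) (hB : B.Nonempty) (hP : degreePairs 𝓕 A B = degreePairs 𝓖 A B)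
    (hT : IsTree 𝓕 A B T) : IsTree 𝓖 A B T := by
  induction hN : A.card + B.card using Nat.strong_induction_on generalizing A B T with
  | _ N ih =>
  obtain ⟨a, ha⟩ := hA
  obtain ⟨b, hab⟩ := hT.2.exists_edge hB ha
  -- Deleting a leaf empties a side only when the tree is a single edge, which is the base case.
  have hsmall : A.card = 1 → B.card = 1 → IsTree 𝓖 A B T := fun hA1 hB1 => by
    obtain ⟨j, rfl⟩ := card_eq_one.1 hA1
    obtain ⟨i, rfl⟩ := card_eq_one.1 hB1
    obtain ⟨T', hT', -⟩ : (deg T, deg (flip T)) ∈ degreePairs 𝓖 {j} {i} := hP ▸ ⟨T, hT, rfl, rfl⟩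
    have key : ∀ {S : ι → κ → Prop}, TreeOn {j} {i} S → ∀ j' i', S j' i' ↔ j' = j ∧ i' = i :=
      fun {S} hS j' i' => by
        refine ⟨fun hh => by simpa using hS.mem _ _ hh, ?_⟩
        rintro ⟨rfl, rfl⟩
        obtain ⟨i'', hi⟩ := hS.exists_edge (by simp) (mem_singleton_self j')
        have : i'' = i' := by simpa using (hS.mem _ _ hi).2
        rwa [← this]
    have : T = T' := by
      funext j' i'
      rw [key hT.2, key hT'.2]
    rw [this]
    exact hT'
  have hleaf1 : ∀ {j i}, IsLeaf T j i → A.erase j = ∅ → A.card = 1 ∧ B.card = 1 := by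
    intro j i hl he
    have hj := (hT.2.mem _ _ hl.1).1
    have hA1 : A.card = 1 := by rw [← card_erase_add_one hj, he, card_empty]
    refine ⟨hA1, ?_⟩
    have hs := hT.2.sum_deg ⟨a, ha⟩
    rw [sum_eq_single j (fun k _ hk => by
      by_contra hne
      have := mem_erase.2 ⟨hk, (hT.2.deg_ne_zero_iff hB k).1 hne⟩
      simp [he] at this) (by simp), deg_eq_one_iff.2 ⟨i, hl⟩] at hs
    omega
  have hleaf2 : ∀ {j i}, IsLeaf (flip T) i j → B.erase i = ∅ → A.card = 1 ∧ B.card = 1 := by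
    intro j i hl he
    have hi := (hT.2.flip.mem _ _ hl.1).1
    have hB1 : B.card = 1 := by rw [← card_erase_add_one hi, he, card_empty]
    refine ⟨?_, hB1⟩
    have hs := hT.2.flip.sum_deg hB
    rw [sum_eq_single i (fun k _ hk => by
      by_contra hne
      have := mem_erase.2 ⟨hk, (hT.2.flip.deg_ne_zero_iff ⟨a, ha⟩ k).1 hne⟩
      simp [he] at this) (by simp), deg_eq_one_iff.2 ⟨j, hl⟩] at hs
    omega
  rcases hT.2.acyclic.exists_leaf ⟨a, b, hab⟩ with ⟨j, i, hl⟩ | ⟨i, j, hl⟩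
  · rcases (A.erase j).eq_empty_or_nonempty with he | hA'
    · exact hsmall (hleaf1 hl he).1 (hleaf1 hl he).2
    · refine h.isTree_of_leaf h' hP hA' (fun hP' S hS => ?_) hT hl
      have := card_erase_lt_of_mem (hT.2.mem _ _ hl.1).1
      exact ih _ (by omega) hA' hB hP' hS rfl
  · rcases (B.erase i).eq_empty_or_nonempty with he | hB'
    · exact hsmall (hleaf2 hl he).1 (hleaf2 hl he).2
    · refine (h.flip.isTree_of_leaf h'.flip (by rw [degreePairs_flip, degreePairs_flip, hP]) hB'
        (fun hP' S hS => ?_) hT.flip hl).flip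
      have := card_erase_lt_of_mem (hT.2.flip.mem _ _ hl.1).1
      refine (ih _ (by omega) ⟨a, ha⟩ hB' ?_ hS.flip rfl).flip
      have e := congrArg (Set.preimage Prod.swap) hP'
      rw [degreePairs_flip, degreePairs_flip] at e
      exact e

/-- A triangulation is determined by its degree pairs. -/
lemma eq_of_degreePairs_eq [Nonempty ι] [Nonempty κ] (h : IsTriangulation 𝓕)
    (h' : IsTriangulation 𝓖) (hP : degreePairs 𝓕 univ univ = degreePairs 𝓖 univ univ) :
    𝓕 = 𝓖 := by
  funext F
  refine propext ⟨fun hF => ?_, fun hF => ?_⟩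
  · obtain ⟨T, hT, hFT⟩ := h.exists_tree_ge hF
    exact h'.mono (h.isTree_of_degreePairs_eq h' univ_nonempty univ_nonempty hP hT).1 hFT
  · obtain ⟨T, hT, hFT⟩ := h'.exists_tree_ge hF
    exact h.mono (h'.isTree_of_degreePairs_eq h univ_nonempty univ_nonempty hP.symm hT).1 hFT

end IsTriangulation

/-! ### Counting degree vectors and bijections. -/

section Counting

/-- The vectors of `m` positive integers with sum `N - 1`. -/
abbrev DegreeVector (m N : ℕ) : Type := {l : Fin m → ℕ // (∀ j, l j ≠ 0) ∧ ∑ j, l j + 1 = N}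

/-- Positive vectors correspond to compositions, by subtracting one from each entry. -/
noncomputable def degreeVectorEquiv (m k : ℕ) :
    DegreeVector m (m + (k + 1)) ≃ (univ : Finset (Fin m)).finsuppAntidiag k where
  toFun l := ⟨Finsupp.equivFunOnFinite.symm fun j => l.1 j - 1, by
    rw [mem_finsuppAntidiag]
    refine ⟨?_, subset_univ _⟩
    have h1 : ∑ j, l.1 j = ∑ j, (l.1 j - 1) + m := by
      rw [sum_congr rfl fun j _ => (Nat.sub_add_cancel (Nat.pos_of_ne_zero (l.2.1 j))).symm]
      simp [sum_add_distrib]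
    have h2 := l.2.2
    simp only [Finsupp.equivFunOnFinite_symm_apply_apply]
    omega⟩
  invFun a := ⟨fun j => a.1 j + 1, fun j => Nat.succ_ne_zero _, by
    have : ∑ j, a.1 j = k := (mem_finsuppAntidiag.1 a.2).1
    simp only [sum_add_distrib, sum_const, card_univ, Fintype.card_fin, smul_eq_mul, mul_one]
    omega⟩
  left_inv l := Subtype.ext <| funext fun j => by
    simpa using Nat.sub_add_cancel (Nat.pos_of_ne_zero (l.2.1 j))
  right_inv a := Subtype.ext <| by
    ext j
    simp

instance (m k : ℕ) : Finite (DegreeVector m (m + (k + 1))) :=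
  Finite.of_equiv _ (degreeVectorEquiv m k).symm

lemma card_degreeVector (m k : ℕ) :
    Nat.card (DegreeVector m (m + (k + 1))) = (m + k - 1).choose k := by
  rw [Nat.card_congr (degreeVectorEquiv m k), Nat.card_eq_fintype_card, Fintype.card_coe,
    card_finsuppAntidiag_nat_eq_choose, card_fin]

variable {n d : ℕ} {𝓕 𝓖 : (Fin n → Fin d → Prop) → Prop}

lemma degreeVector_of_treeOn (hn : 1 ≤ n) (hd : 1 ≤ d) {T : Fin n → Fin d → Prop}
    (hT : TreeOn univ univ T) : (∀ j, deg T j ≠ 0) ∧ ∑ j, deg T j + 1 = n + d := by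
  have : Nonempty (Fin n) := ⟨⟨0, hn⟩⟩
  have : Nonempty (Fin d) := ⟨⟨0, hd⟩⟩
  exact ⟨fun j => (hT.deg_ne_zero_iff univ_nonempty j).2 (mem_univ j),
    by simpa using hT.sum_deg univ_nonempty⟩

/-- The degree pairs of a triangulation form the graph of a bijection. -/
lemma IsTriangulation.exists_equiv (h : IsTriangulation 𝓕) (hn : 1 ≤ n) (hd : 1 ≤ d) :
    ∃ e : DegreeVector n (n + d) ≃ DegreeVector d (d + n),
      degreePairs 𝓕 univ univ = Set.range fun l => (l.1, (e l).1) := by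
  have : Nonempty (Fin n) := ⟨⟨0, hn⟩⟩
  have : Nonempty (Fin d) := ⟨⟨0, hd⟩⟩
  choose T hT hTd using fun l : DegreeVector n (n + d) =>
    h.exists_tree (A := univ) (B := univ) univ_nonempty univ_nonempty (l := l.1)
      (fun j => by simp [l.2.1 j]) (by simpa using l.2.2)
  let f : DegreeVector n (n + d) → DegreeVector d (d + n) := fun l =>
    ⟨deg (flip (T l)), degreeVector_of_treeOn hd hn (hT l).2.flip⟩
  have hf : Function.Bijective f := by
    constructor
    · intro l l' hl
      have := h.tree_unique_flip (hT l) (hT l') (congrArg Subtype.val hl)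
      exact Subtype.ext (by rw [← hTd l, ← hTd l', this])
    · intro r
      obtain ⟨S, hS, hSr⟩ := h.exists_tree_flip (A := univ) (B := univ) univ_nonempty
        univ_nonempty (r := r.1) (fun j => by simp [r.2.1 j])
        (by simpa [add_comm n d] using r.2.2)
      let l : DegreeVector n (n + d) := ⟨deg S, degreeVector_of_treeOn hn hd hS.2⟩
      refine ⟨l, Subtype.ext ?_⟩
      have : T l = S := h.tree_unique (hT l) hS (hTd l)
      change deg (flip (T l)) = r.1
      rw [this, hSr]
  refine ⟨Equiv.ofBijective f hf, ?_⟩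
  ext ⟨a, b⟩
  constructor
  · rintro ⟨S, hS, rfl, rfl⟩
    let l : DegreeVector n (n + d) := ⟨deg S, degreeVector_of_treeOn hn hd hS.2⟩
    have hTS : T l = S := h.tree_unique (hT l) hS (hTd l)
    refine ⟨l, Prod.ext rfl ?_⟩
    change deg (flip (T l)) = deg (flip S)
    rw [hTS]
  · rintro ⟨l, hl⟩
    rw [← hl]
    exact ⟨T l, hT l, hTd l, rfl⟩

/-- A set that injects into the combinatorial triangulations has at most `N!` elements, where `N`
is the number of degree vectors. -/
lemma finite_and_ncard_le {α : Type*} (hn : 1 ≤ n) (hd : 1 ≤ d) {S : Set α}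
    (f : α → (Fin n → Fin d → Prop) → Prop) (hf : ∀ a ∈ S, IsTriangulation (f a))
    (hinj : Set.InjOn f S) :
    S.Finite ∧ S.ncard ≤ ((n + d - 2).choose (d - 1)).factorial := by
  obtain ⟨n, rfl⟩ := Nat.exists_eq_add_of_le' hn
  obtain ⟨d, rfl⟩ := Nat.exists_eq_add_of_le' hd
  choose e he using fun a : S => (hf a a.2).exists_equiv hn hd
  have hL := card_degreeVector (n + 1) d
  have hR := card_degreeVector (d + 1) n
  have hsymm : (d + 1 + n - 1).choose n = (n + 1 + d - 1).choose d :=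
    (Nat.choose_symm_of_eq_add (b := d) (by omega)).trans (by congr 1; omega)
  have einj : Function.Injective e := fun a b hab => by
    refine Subtype.ext (hinj a.2 b.2 ((hf a a.2).eq_of_degreePairs_eq (hf b b.2) ?_))
    rw [he, he, hab]
  have hfin : Finite S := Finite.of_injective e einj
  refine ⟨hfin, ?_⟩
  -- Any reference bijection turns the bijections into permutations of a set of `N` elements.
  obtain ⟨e₀⟩ : Nonempty (DegreeVector (n + 1) (n + 1 + (d + 1)) ≃
      DegreeVector (d + 1) (d + 1 + (n + 1))) := by
    rw [← Finite.card_eq, hL, hR, hsymm]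
  calc S.ncard = Nat.card S := rfl
    _ ≤ Nat.card (DegreeVector (n + 1) (n + 1 + (d + 1)) ≃
      DegreeVector (d + 1) (d + 1 + (n + 1))) := Nat.card_le_card_of_injective e einj
    _ = Nat.card (Equiv.Perm (DegreeVector (n + 1) (n + 1 + (d + 1)))) :=
      Nat.card_congr ((Equiv.refl _).equivCongr e₀.symm)
    _ = _ := by
      rw [Nat.card_perm, hL]
      congr 2

end Counting

/-! ### From geometric to combinatorial triangulations. -/

section Geometry

variable {n d : ℕ}

/-- The vertex `(e_j, e_i)` of the product of simplices. -/
def vertex (p : Fin n × Fin d) : (Fin n → ℝ) × (Fin d → ℝ) := (Pi.single p.1 1, Pi.single p.2 1)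

lemma vertex_injective : Function.Injective (vertex : Fin n × Fin d → _) := by
  rintro ⟨j, i⟩ ⟨j', i'⟩ h
  have h1 := congrFun (congrArg Prod.fst h) j
  have h2 := congrFun (congrArg Prod.snd h) i
  simp only [vertex, Pi.single_eq_same, Pi.single_apply] at h1 h2
  ext1
  · simpa using h1
  · simpa using h2

/-- The edges of a bipartite graph. -/
noncomputable def edges (F : Fin n → Fin d → Prop) : Finset (Fin n × Fin d) :=
  univ.filter fun p => F p.1 p.2

lemma mem_edges {F : Fin n → Fin d → Prop} {p : Fin n × Fin d} : p ∈ edges F ↔ F p.1 p.2 := by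
  simp [edges]

/-- The set of vertices of the product of simplices given by a bipartite graph. -/
noncomputable def face (F : Fin n → Fin d → Prop) : Finset ((Fin n → ℝ) × (Fin d → ℝ)) :=
  (edges F).image vertex

lemma vertex_mem_face {F : Fin n → Fin d → Prop} {p : Fin n × Fin d} :
    vertex p ∈ face F ↔ F p.1 p.2 := by
  rw [face, vertex_injective.mem_finset_image, mem_edges]

lemma face_nonempty {F : Fin n → Fin d → Prop} : (face F).Nonempty ↔ ∃ j i, F j i := by
  rw [face, image_nonempty]
  exact ⟨fun ⟨p, hp⟩ => ⟨p.1, p.2, mem_edges.1 hp⟩, fun ⟨j, i, h⟩ => ⟨(j, i), mem_edges.2 h⟩⟩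

lemma face_mono {F G : Fin n → Fin d → Prop} (h : ∀ j i, F j i → G j i) : face F ⊆ face G :=
  image_subset_image fun _ hp => mem_edges.2 (h _ _ (mem_edges.1 hp))

lemma face_inter (F G : Fin n → Fin d → Prop) :
    face F ∩ face G = face fun j i => F j i ∧ G j i := by
  rw [face, face, face, ← image_inter _ _ vertex_injective]
  congr 1
  ext p
  simp [mem_edges]

lemma sum_edges {E : Type*} [AddCommMonoid E] [Module ℝ E] {F : Fin n → Fin d → Prop}
    {M : Fin n → Fin d → ℝ} (hM : SuppIn M F) (g : Fin n × Fin d → E) :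
    ∑ p ∈ edges F, M p.1 p.2 • g p = ∑ p, M p.1 p.2 • g p :=
  sum_subset (subset_univ _) fun p _ hp => by
    rw [not_imp_comm.1 (hM p.1 p.2) fun hF => hp (mem_edges.2 hF), zero_smul]

lemma sum_edges_eq {F : Fin n → Fin d → Prop} {M : Fin n → Fin d → ℝ} (hM : SuppIn M F) :
    ∑ p ∈ edges F, M p.1 p.2 = ∑ j, ∑ i, M j i := by
  rw [← Fintype.sum_prod_type']
  simpa using sum_edges hM fun _ => (1 : ℝ)

lemma sum_smul_vertex (M : Fin n → Fin d → ℝ) :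
    ∑ p : Fin n × Fin d, M p.1 p.2 • vertex p = (fun j => ∑ i, M j i, fun i => ∑ j, M j i) := by
  refine Prod.ext (funext fun j => ?_) (funext fun i => ?_)
  · simp [Prod.fst_sum, Finset.sum_apply, vertex, Fintype.sum_prod_type, Pi.single_apply]
  · simp [Prod.snd_sum, Finset.sum_apply, vertex, Fintype.sum_prod_type_right, Pi.single_apply]

lemma hasMargins_iff {M : Fin n → Fin d → ℝ} {x : Fin n → ℝ} {y : Fin d → ℝ} :
    HasMargins M x y ↔ ∑ p : Fin n × Fin d, M p.1 p.2 • vertex p = (x, y) := by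
  rw [sum_smul_vertex, Prod.ext_iff, funext_iff, funext_iff, HasMargins]

lemma mem_convexHull_face {F : Fin n → Fin d → Prop} {x : Fin n → ℝ} {y : Fin d → ℝ} :
    (x, y) ∈ convexHull ℝ (face F : Set ((Fin n → ℝ) × (Fin d → ℝ))) ↔
      ∃ M : Fin n → Fin d → ℝ, (∀ j i, 0 ≤ M j i) ∧ SuppIn M F ∧ ∑ j, ∑ i, M j i = 1 ∧
        HasMargins M x y := by
  constructor
  · intro h
    obtain ⟨w, hw0, hw1, hw⟩ := Finset.mem_convexHull'.1 h
    rw [face, sum_image vertex_injective.injOn] at hw1 hw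
    have hM : SuppIn (fun j i => if F j i then w (vertex (j, i)) else 0) F := fun j i hji => by
      by_contra hF
      simp [hF] at hji
    refine ⟨fun j i => if F j i then w (vertex (j, i)) else 0, fun j i => ?_, hM, ?_, ?_⟩
    · dsimp only
      split_ifs with hF
      · exact hw0 _ (vertex_mem_face.2 hF)
      · exact le_rfl
    · rw [← sum_edges_eq hM, ← hw1]
      exact sum_congr rfl fun p hp => if_pos (mem_edges.1 hp)
    · rw [hasMargins_iff, ← sum_edges hM, ← hw]
      exact sum_congr rfl fun p hp => by rw [if_pos (mem_edges.1 hp)]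
  · rintro ⟨M, hM0, hMF, hM1, hM⟩
    rw [← hasMargins_iff.1 hM, ← sum_edges hMF]
    refine (convex_convexHull ℝ _).sum_mem (fun p _ => hM0 _ _) ?_ fun p hp =>
      subset_convexHull ℝ _ (vertex_mem_face.2 (mem_edges.1 hp))
    rw [sum_edges_eq hMF, hM1]

/-- The bipartite graphs that are faces of a simplicial complex, or empty. -/
def faceFamily (K : Geometry.SimplicialComplex ℝ ((Fin n → ℝ) × (Fin d → ℝ))) :
    (Fin n → Fin d → Prop) → Prop := fun F => (∃ j i, F j i) → face F ∈ K.faces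

variable {K K' : Geometry.SimplicialComplex ℝ ((Fin n → ℝ) × (Fin d → ℝ))}

/-- Zero row sums make the coefficients sum to zero, so affine independence of the face suffices. -/
lemma acyclic_of_face_mem {F : Fin n → Fin d → Prop} (hF : face F ∈ K.faces) : Acyclic F := by
  intro M hM hM0
  let φ : edges F ↪ face F :=
    ⟨fun p => ⟨vertex p.1, vertex_mem_face.2 (mem_edges.1 p.2)⟩,
      fun p q h => Subtype.ext (vertex_injective (congrArg Subtype.val h))⟩
  have hind := (K.indep hF).comp_embedding φ
  have key := hind.eq_zero_of_sum_eq_zero (s := univ) (w := fun p => M p.1.1 p.1.2) (by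
      rw [sum_coe_sort (edges F) fun p => M p.1 p.2, sum_edges_eq hM]
      exact sum_eq_zero fun j _ => hM0.1 j) (by
      refine (sum_coe_sort (edges F) fun p => M p.1 p.2 • vertex p).trans ?_
      rw [sum_edges hM, hasMargins_iff.1 hM0]
      rfl)
  funext j i
  by_contra hne
  exact hne (key ⟨(j, i), mem_edges.2 (hM j i hne)⟩ (mem_univ _))

lemma eq_zero_of_sum_eq_zero {M : Fin n → Fin d → ℝ} {x : Fin n → ℝ} {y : Fin d → ℝ}
    (hM : ∀ j i, 0 ≤ M j i) (hMx : HasMargins M x y) (h : ∑ j, x j = 0) : M = 0 := by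
  simp_rw [← hMx.1] at h
  funext j i
  have h1 := (sum_eq_zero_iff_of_nonneg fun j _ => sum_nonneg fun i _ => hM j i).1 h j (mem_univ j)
  exact (sum_eq_zero_iff_of_nonneg fun i _ => hM j i).1 h1 i (mem_univ i)

lemma exists_face_eq (hK : K ∈ simplexProductTriangulations n d)
    {s : Finset ((Fin n → ℝ) × (Fin d → ℝ))} (hs : s ∈ K.faces) : ∃ F, face F = s := by
  refine ⟨fun j i => vertex (j, i) ∈ s, ?_⟩
  ext v
  refine ⟨fun hv => ?_, fun hv => ?_⟩
  · obtain ⟨p, hp, rfl⟩ := mem_image.1 hv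
    exact mem_edges.1 hp
  · obtain ⟨p, rfl⟩ := hK.2 (K.down_closed hs (singleton_subset_iff.2 hv) (singleton_nonempty v))
    exact vertex_mem_face.2 hv

/-- After scaling to total mass one, existence says that the faces cover the polytope, and
uniqueness that two faces meet in a common face. Mass zero is handled apart, by the zero matrix. -/
lemma isTriangulation_faceFamily (hK : K ∈ simplexProductTriangulations n d) :
    IsTriangulation (faceFamily K) where
  mono {F G} hF hGF hG := by
    obtain ⟨j, i, hji⟩ := hG
    exact K.down_closed (hF ⟨j, i, hGF j i hji⟩) (face_mono hGF) (face_nonempty.2 ⟨j, i, hji⟩)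
  unique {M N x y} hM hN hFM hFN hMx hNx := by
    by_cases hx : ∑ j, x j = 0
    · rw [eq_zero_of_sum_eq_zero hM hMx hx, eq_zero_of_sum_eq_zero hN hNx hx]
    have hne : ∀ {L : Fin n → Fin d → ℝ}, HasMargins L x y → ∃ j i, supp L j i := fun {L} hL => by
      by_contra! hcon
      refine hx ?_
      simp_rw [← hL.1]
      exact sum_eq_zero fun j _ => sum_eq_zero fun i _ => not_not.1 (hcon j i)
    have hpos : 0 ≤ ∑ j, x j := by
      simp_rw [← hMx.1]
      exact sum_nonneg fun j _ => sum_nonneg fun i _ => hM j i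
    set t := ∑ j, x j with ht
    have hmem : ∀ {L : Fin n → Fin d → ℝ}, (∀ j i, 0 ≤ L j i) → HasMargins L x y →
        (t⁻¹ • x, t⁻¹ • y) ∈ convexHull ℝ (face (supp L) : Set ((Fin n → ℝ) × (Fin d → ℝ))) :=
      fun {L} hL hLx => mem_convexHull_face.2 ⟨t⁻¹ • L,
        fun j i => mul_nonneg (inv_nonneg.2 hpos) (hL j i),
        fun j i hji h0 => hji (by simp [h0]),
        by simp_rw [(hLx.smul t⁻¹).1, Pi.smul_apply, ← smul_sum, ← ht, smul_eq_mul,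
          inv_mul_cancel₀ hx], hLx.smul t⁻¹⟩
    -- The common point is carried by a matrix `L` on the common edges; acyclicity of either face
    -- identifies `L` with both rescaled matrices.
    have hp := K.inter_subset_convexHull (hFM (hne hMx)) (hFN (hne hNx))
      ⟨hmem hM hMx, hmem hN hNx⟩
    rw [← coe_inter, face_inter] at hp
    obtain ⟨L, -, hLF, -, hLm⟩ := mem_convexHull_face.1 hp
    have e1 := (acyclic_of_face_mem (hFM (hne hMx))).eq_of_hasMargins
      (M := t⁻¹ • M) (fun j i hji h0 => hji (by simp [h0])) (fun j i hji => (hLF j i hji).1)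
      (hMx.smul t⁻¹) hLm
    have e2 := (acyclic_of_face_mem (hFN (hne hNx))).eq_of_hasMargins
      (M := t⁻¹ • N) (fun j i hji h0 => hji (by simp [h0])) (fun j i hji => (hLF j i hji).2)
      (hNx.smul t⁻¹) hLm
    exact smul_right_injective _ (inv_ne_zero hx) (e1.trans e2.symm)
  exists_matrix x y hx hy hxy := by
    by_cases h0 : ∑ j, x j = 0
    · have hx0 : ∀ j, x j = 0 := fun j =>
        (sum_eq_zero_iff_of_nonneg fun j _ => hx j).1 h0 j (mem_univ j)
      have hy0 : ∀ i, y i = 0 := fun i =>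
        (sum_eq_zero_iff_of_nonneg fun i _ => hy i).1 (hxy ▸ h0) i (mem_univ i)
      exact ⟨0, fun j i => le_rfl, fun ⟨j, i, hji⟩ => absurd rfl hji, fun j => by simp [hx0],
        fun i => by simp [hy0]⟩
    set t := ∑ j, x j with ht
    have hpos : 0 ≤ t := sum_nonneg fun j _ => hx j
    have hp : (t⁻¹ • x, t⁻¹ • y) ∈ K.space := by
      rw [hK.1]
      refine ⟨⟨fun j => mul_nonneg (inv_nonneg.2 hpos) (hx j), ?_⟩,
        ⟨fun i => mul_nonneg (inv_nonneg.2 hpos) (hy i), ?_⟩⟩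
      · simp_rw [Pi.smul_apply, ← smul_sum, ← ht, smul_eq_mul, inv_mul_cancel₀ h0]
      · simp_rw [Pi.smul_apply, ← smul_sum, ← hxy, smul_eq_mul, inv_mul_cancel₀ h0]
    obtain ⟨s, hs, hps⟩ := Geometry.SimplicialComplex.mem_space_iff.1 hp
    obtain ⟨F, rfl⟩ := exists_face_eq hK hs
    obtain ⟨M, hM0, hMF, -, hM⟩ := mem_convexHull_face.1 hps
    have hMF' : ∀ j i, supp (t • M) j i → F j i := fun j i hji =>
      hMF j i fun h => hji (by simp [h])
    refine ⟨t • M, fun j i => mul_nonneg hpos (hM0 j i), fun ⟨j, i, hji⟩ => ?_, ?_⟩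
    · exact K.down_closed hs (face_mono hMF') (face_nonempty.2 ⟨j, i, hji⟩)
    · simpa [smul_smul, mul_inv_cancel₀ h0] using hM.smul t

lemma faces_subset_of_faceFamily_eq (hK : K ∈ simplexProductTriangulations n d)
    (h : faceFamily K = faceFamily K') : K.faces ⊆ K'.faces := by
  intro s hs
  obtain ⟨F, rfl⟩ := exists_face_eq hK hs
  have hF : faceFamily K F := fun _ => hs
  rw [h] at hF
  exact hF (face_nonempty.1 (K.nonempty_of_mem_faces hs))

lemma faceFamily_injOn : Set.InjOn faceFamily (simplexProductTriangulations n d) :=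
  fun _ hK _ hK' h => Geometry.SimplicialComplex.ext
    ((faces_subset_of_faceFamily_eq hK h).antisymm (faces_subset_of_faceFamily_eq hK' h.symm))

end Geometry

end SimplexProduct

theorem mainTheorem11 (n d : ℕ) (hn : 1 ≤ n) (hd : 1 ≤ d) :
    (simplexProductTriangulations n d).Finite ∧
      (simplexProductTriangulations n d).ncard ≤ ((n + d - 2).choose (d - 1)).factorial :=
  SimplexProduct.finite_and_ncard_le hn hd SimplexProduct.faceFamily
    (fun _ hK => SimplexProduct.isTriangulation_faceFamily hK) SimplexProduct.faceFamily_injOn
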